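/- \textbf{Notation.} Let $\mathbb{N}=\{1,2,3,\dots\}$ and $[n]=\{1,\dots,n\}$. Let $S_\infty$ be the group of permutations of $\mathbb{N}$ fixing all but finitely many points, let $s_i=(i,i+1)$, and for $n\ge 0$ let $\mathcal{I}_n$ be the set of $z\in S_\infty$ with $z^2=1$ and $z(i)=i$ for all $i>n$. If $z\in\mathcal{I}_n$ has fixed points $i_1<\dots<i_k$ in $[n]$, define the permutation of $\mathbb{N}$ $$\operatorname{FPF}_n(z)=z\cdot(i_1,n+1)(i_2,n+2)\cdots(i_k,n+k)\cdot(n+k+1,n+k+2)(n+k+3,n+k+4)\cdots .$$ A \emph{reduced word} for $w\in S_\infty$ is a word $a_1a_2\cdots a_l$ of positive integers of shortest possible length such that $w=s_{a_1}s_{a_2}\cdots s_{a_l}$. The \emph{reading word} of a finite set $D\subset\mathbb{N}\times\mathbb{N}$ lists the numbers $i+j-1$ as $(i,j)$ ranges over $D$ in the order in which $(i,-j)$ increases lexicographically. Let $\mathcal{RP}(w)$ be the set of finite $D\subset\mathbb{N}\times\mathbb{N}$ whose reading word is a reduced word for $w$. If $z=\operatorname{FPF}_m(y)$, where $m$ is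 even and $y\in\mathcal{I}_m$ has no fixed points in $[m]$, let $$\mathcal{FP}(z)=\bigl\{\{(i,j)\in D: i>j\} : D\in\mathcal{RP}(y),\ D^T=D\bigr\},$$ where $D^T$ is the transpose of $D$. (Every element of $\operatorname{FPF}_n(\mathcal{I}_n)$ has this form, and $\mathcal{FP}(z)$ does not depend on the choice of $(m,y)$.) Let $\triangle_n=\{(i,j)\in[n]\times[n]: i>j\}$. A \emph{simplicial complex} $\Delta$ with finite vertex set $V$ is a collection of subsets of $V$ (its faces) closed under taking subsets; vertices need not be faces, and $\Delta=\varnothing$ and $\Delta=\{\varnothing\}$ are allowed. Its inclusion-maximal faces are its \emph{facets}, and $\Delta$ is \emph{pure} if all facets have the same size. For $v\in V$ let $\operatorname{del}_{v}\Delta=\{E\in\Delta: v\notin E\}$ and $\operatorname{link}_{v}\Delta=\{E\in\Delta: v\notin E,\ E\cup\{v\}\in\Delta\}$, both with vertex set $V\setminus\{v\}$. Recursively, $\Delta$ is \emph{vertex-decomposable} if $\Delta=\varnothing$, or $\Delta=\{\varnothing\}$, or $\Delta$ is pure and there is $v\in V$ such that $\operatorname{del}_{v}\Delta$ and $\operatorname{link}_{v}\Delta$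 are both vertex-decomposable. The complex $\Delta$ is \emph{shellable} if it is pure and its facets can be listed without repetition as $F_1,\dots,F_t$ such that, for each $i$, the complex $\{E\subseteq F_i : E\subseteq F_j\text{ for some }j<i\}$ is generated by (that is, consists of all subsets of the members of) some set of codimension one faces of $F_i$. For $z\in\operatorname{FPF}_n(\mathcal{I}_n)$ and $Q\subseteq\triangle_n$, the \emph{fpf-subword complex} is the simplicial complex with vertex set $Q$ and faces $$\Sigma(z,Q)=\{S\subseteq Q : Q\setminus S\text{ contains an element of }\mathcal{FP}(z)\}.$$ \textbf{Theorem.} Let $n\ge 0$, $z\in\operatorname{FPF}_n(\mathcal{I}_n)$ and $Q\subseteq\triangle_n$. Then $\Sigma(z,Q)$ is vertex-decomposable, and therefore shellable. -/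

import Mathlib

/-! Indexing convention: the positive integer `i` is represented by the natural number `i - 1`, so
that the permutations of the positive integers are `Equiv.Perm ℕ`, the set `[n]` is `{0, …, n - 1}`,
and the matrix position `(i, j)` is represented by `(i - 1, j - 1)`. -/

namespace FPFSubword

/-! ### Simplicial complexes with a specified vertex set -/

/-- A simplicial complex with (finite) vertex set `vertices`: a collection of subsets of the vertex
set that is closed under taking subsets. Vertices need not be faces, and both the complex with no
face at all and the complex whose only face is `∅` are allowed. -/
structure Complex (α : Type*) where
  vertices : Finset α
  faces : Set (Finset α)
  subset_vertices : ∀ S ∈ faces, S ⊆ vertices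
  down_closed : ∀ S ∈ faces, ∀ T ⊆ S, T ∈ faces

namespace Complex

variable {α : Type*}

/-- The containment-maximal faces. -/
def IsFacet (Δ : Complex α) (F : Finset α) : Prop :=
  F ∈ Δ.faces ∧ ∀ G ∈ Δ.faces, F ⊆ G → F = G

/-- All facets have the same dimension. -/
def IsPure (Δ : Complex α) : Prop :=
  ∀ F G : Finset α, Δ.IsFacet F → Δ.IsFacet G → F.card = G.card

/-- The link of `F`, with vertex set `V \ F`. -/
def link [DecidableEq α] (Δ : Complex α) (F : Finset α) : Complex α where
  vertices := Δ.vertices \ F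
  faces := {E | E ∈ Δ.faces ∧ E ∩ F = ∅ ∧ E ∪ F ∈ Δ.faces}
  subset_vertices := by
    rintro S ⟨hS, hSF, -⟩
    exact Finset.subset_sdiff.2
      ⟨Δ.subset_vertices S hS, Finset.disjoint_iff_inter_eq_empty.2 hSF⟩
  down_closed := by
    rintro S ⟨hS, hSF, hU⟩ T hT
    exact ⟨Δ.down_closed S hS T hT,
      Finset.subset_empty.1 (hSF ▸ Finset.inter_subset_inter_right hT),
      Δ.down_closed _ hU _ (Finset.union_subset_union_left hT)⟩

/-- The deletion of `F`, with vertex set `V \ F`. -/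
def deletion [DecidableEq α] (Δ : Complex α) (F : Finset α) : Complex α where
  vertices := Δ.vertices \ F
  faces := {E | E ∈ Δ.faces ∧ E ∩ F = ∅}
  subset_vertices := by
    rintro S ⟨hS, hSF⟩
    exact Finset.subset_sdiff.2
      ⟨Δ.subset_vertices S hS, Finset.disjoint_iff_inter_eq_empty.2 hSF⟩
  down_closed := by
    rintro S ⟨hS, hSF⟩ T hT
    exact ⟨Δ.down_closed S hS T hT,
      Finset.subset_empty.1 (hSF ▸ Finset.inter_subset_inter_right hT)⟩

/-- Vertex-decomposability: `∅` and `{∅}` are vertex-decomposable, and a pure complex is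
vertex-decomposable if the deletion and the link of some vertex both are. -/
inductive IsVertexDecomposable [DecidableEq α] : Complex α → Prop
  | no_face (Δ : Complex α) (h : Δ.faces = ∅) : IsVertexDecomposable Δ
  | only_empty_face (Δ : Complex α) (h : Δ.faces = {∅}) : IsVertexDecomposable Δ
  | step (Δ : Complex α) (hpure : Δ.IsPure) (v : α) (hv : v ∈ Δ.vertices)
      (hdel : IsVertexDecomposable (Δ.deletion {v}))
      (hlink : IsVertexDecomposable (Δ.link {v})) : IsVertexDecomposable Δ

/-- A shelling: a list `F₁, …, F_t` of all facets, without repetition, such that for each `i` the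
complex of those faces of `F_i` that are also faces of some `F_j` with `j < i` is generated by a set
`𝒢` of codimension one faces of `F_i`. -/
def IsShelling (Δ : Complex α) (L : List (Finset α)) : Prop :=
  L.Nodup ∧ (∀ F, F ∈ L ↔ Δ.IsFacet F) ∧
    ∀ i : Fin L.length, ∃ 𝒢 : Set (Finset α),
      (∀ G ∈ 𝒢, G ⊆ L.get i ∧ G.card + 1 = (L.get i).card) ∧
      {E : Finset α | E ⊆ L.get i ∧ ∃ j < i, E ⊆ L.get j} = {E : Finset α | ∃ G ∈ 𝒢, E ⊆ G}

/-- A complex is shellable if it is pure and has a shelling. -/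
def IsShellable (Δ : Complex α) : Prop :=
  Δ.IsPure ∧ ∃ L : List (Finset α), Δ.IsShelling L

end Complex

/-! ### Involutions and fixed-point-free standardization -/

/-- The set `I_n` of permutations `z` with `z² = 1` that fix every integer outside `[n]`. -/
def involutions (n : ℕ) : Set (Equiv.Perm ℕ) :=
  {z | z * z = 1 ∧ ∀ i, n ≤ i → z i = i}

/-- The elements of `I_n` with no fixed points in `[n]`. -/
def fpfInvolutions (n : ℕ) : Set (Equiv.Perm ℕ) :=
  {z | z ∈ involutions n ∧ ∀ i, i < n → z i ≠ i}

/-- The underlying map of `pairsFrom a`. -/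
def pairsFromFun (a i : ℕ) : ℕ :=
  if i < a then i else if Even (i - a) then i + 1 else i - 1

theorem pairsFromFun_involutive (a : ℕ) : Function.Involutive (pairsFromFun a) := by
  intro i
  unfold pairsFromFun
  simp only [Nat.even_iff]
  split_ifs <;> omega

/-- The infinite product of disjoint transpositions `(a, a + 1)(a + 2, a + 3)(a + 4, a + 5) ⋯`. -/
def pairsFrom (a : ℕ) : Equiv.Perm ℕ :=
  (pairsFromFun_involutive a).toPerm

/-- The fixed points of `z` in `[n]`, in increasing order. -/
def fixedPointList (n : ℕ) (z : Equiv.Perm ℕ) : List ℕ :=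
  (List.range n).filter (fun i => z i = i)

/-- The product of transpositions `(i₁, n + 1)(i₂, n + 2) ⋯ (i_k, n + k)`, where `i₁ < ⋯ < i_k` are
the fixed points of `z` in `[n]` (with the entries `n + 1, …, n + k` represented by
`n, …, n + k - 1`). -/
def fixedPointMatching (n : ℕ) (z : Equiv.Perm ℕ) : Equiv.Perm ℕ :=
  ((fixedPointList n z).mapIdx (fun a i => Equiv.swap i (n + a))).prod

/-- The fixed-point-free standardization `FPF_n(z) = z z' z''` of `z ∈ I_n`. -/
def fpfStd (n : ℕ) (z : Equiv.Perm ℕ) : Equiv.Perm ℕ :=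
  z * fixedPointMatching n z * pairsFrom (n + (fixedPointList n z).length)

/-! ### Pipe dreams -/

/-- The embedding of positions into the lexicographic order in which `(i, -j)` increases. -/
def readingKey : ℕ × ℕ ↪ ℕ ×ₗ ℕᵒᵈ where
  toFun p := toLex (p.1, OrderDual.toDual p.2)
  inj' := by
    rintro ⟨a, b⟩ ⟨c, d⟩ h
    simpa using h

/-- The pipe dream reading word of `D`: the letters `i + j - 1` for `(i, j) ∈ D`, reading the rows
in order and each row from right to left. In the present indexing, where the letter `a` is
represented by `a - 1`, the position `(i, j)` contributes the letter `i + j`. -/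
def readingWord (D : Finset (ℕ × ℕ)) : List ℕ :=
  ((D.map readingKey).sort (· ≤ ·)).map
    (fun q => (ofLex q).1 + OrderDual.ofDual (ofLex q).2)

/-- The product `s_{a₁} s_{a₂} ⋯ s_{a_l}` of the simple transpositions `s_a = (a, a + 1)`. -/
def wordProd (a : List ℕ) : Equiv.Perm ℕ :=
  (a.map (fun i => Equiv.swap i (i + 1))).prod

/-- A reduced word for `w`: a word of shortest possible length whose product is `w`. -/
def IsReducedWord (w : Equiv.Perm ℕ) (a : List ℕ) : Prop :=
  wordProd a = w ∧ ∀ b : List ℕ, wordProd b = w → a.length ≤ b.length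

/-- The set `RP(w)` of (reduced) pipe dreams for `w`. -/
def pipeDreams (w : Equiv.Perm ℕ) : Set (Finset (ℕ × ℕ)) :=
  {D | IsReducedWord w (readingWord D)}

/-- The set `FP(z)` of fpf-involution pipe dreams for `z`: the strictly lower triangular parts of
the transpose-invariant pipe dreams for `y`, where `z = FPF_m(y)` with `m` even and `y ∈ I_m`
without fixed points in `[m]`. -/
def fpfPipeDreams (z : Equiv.Perm ℕ) : Set (Finset (ℕ × ℕ)) :=
  {E | ∃ m : ℕ, Even m ∧ ∃ y ∈ fpfInvolutions m, fpfStd m y = z ∧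
    ∃ D ∈ pipeDreams y, D.image Prod.swap = D ∧ E = D.filter (fun p => p.2 < p.1)}

/-- The set of positions `(i, j) ∈ [n] × [n]` with `i > j`. -/
def triangle (n : ℕ) : Finset (ℕ × ℕ) :=
  (Finset.range n ×ˢ Finset.range n).filter (fun p => p.2 < p.1)

/-- The fpf-subword complex `Σ(z, Q)`. -/
def subwordComplex (z : Equiv.Perm ℕ) (Q : Finset (ℕ × ℕ)) : Complex (ℕ × ℕ) where
  vertices := Q
  faces := {S | S ⊆ Q ∧ ∃ D ∈ fpfPipeDreams z, D ⊆ Q \ S}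
  subset_vertices := fun _ hS => hS.1
  down_closed := by
    rintro S ⟨hS, D, hD, hDS⟩ T hT
    exact ⟨hT.trans hS, D, hD, hDS.trans (Finset.sdiff_subset_sdiff subset_rfl hT)⟩

end FPFSubword

namespace FPFSubword

open Equiv

/-! ### Words and the exchange property -/

/-! Write Θ = `pairsFrom 0` for the product (1,2)(3,4)(5,6)⋯. The first half of the argument
replaces symmetric pipe dreams by words: a strictly lower triangular set E lies in FP(z) exactly
when its reading word is a shortest word b with b⁻¹Θb = z (`mem_fpfPipeDreams`). Up to commutations,
a symmetric set reads as the reverse of the word of E, then its diagonal letters, then the word of E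
(`wordProd_symmetrize`). The diagonal letters give the cycles of Θ inside [m], so y is a conjugate
of these cycles by the word of E. Reducedness matches because every word for y has length at least
2ℓ + m/2, where ℓ is the least length of a word b with b⁻¹Θb = FPF_m(y)
(`exists_fpfConj_of_wordProd`).

The second half is the Knutson–Miller argument for subword complexes. Let q be the last position of
Q in reading order, with simple transposition s. The link of q is Σ(z, Q∖q). The deletion of q is
Σ(z, Q∖q) if no pipe dream inside Q uses q, and Σ(szs, Q∖q) otherwise. The latter rests on an
exchange property for conjugates of Θ (`exists_sublist_fpfConj`): a pipe dream avoiding q still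
contains one for szs. Facets are complements of pipe dreams, which all have the same size, so the
complex is pure and induction on |Q| applies. Shellability follows by listing the facets of the
deletion before those containing the vertex. -/

@[simp] theorem wordProd_nil : wordProd [] = 1 := rfl

@[simp] theorem wordProd_cons (a : ℕ) (b : List ℕ) :
    wordProd (a :: b) = swap a (a + 1) * wordProd b := by simp [wordProd]

theorem wordProd_append (a b : List ℕ) : wordProd (a ++ b) = wordProd a * wordProd b := by
  simp [wordProd]

theorem wordProd_concat (b : List ℕ) (a : ℕ) :
    wordProd (b ++ [a]) = wordProd b * swap a (a + 1) := by simp [wordProd_append]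

theorem wordProd_reverse (b : List ℕ) : wordProd b.reverse = (wordProd b)⁻¹ := by
  induction b with
  | nil => simp
  | cons a b ih => rw [List.reverse_cons, wordProd_concat, ih, wordProd_cons, mul_inv_rev, swap_inv]

/-- A simple transposition preserves the order of every pair other than `a, a + 1`. -/
theorem swap_succ_lt {a p q : ℕ} (h : p < q) (hne : ¬(p = a ∧ q = a + 1)) :
    swap a (a + 1) p < swap a (a + 1) q := by
  simp only [swap_apply_def]
  split_ifs <;> omega

/-- The strong exchange property of the symmetric group. -/
theorem exists_sublist_swap_mul (b : List ℕ) {p q : ℕ} (hpq : p < q)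
    (h : (wordProd b)⁻¹ q < (wordProd b)⁻¹ p) :
    ∃ c, c.Sublist b ∧ c.length + 1 = b.length ∧ wordProd c = swap p q * wordProd b := by
  induction b generalizing p q with
  | nil => simp at h; omega
  | cons a b ih =>
    -- If (p, q) is the pair of the first letter, that letter cancels. Otherwise the reflection
    -- moves past the letter, becoming the conjugate reflection, whose pair keeps its order.
    by_cases hab : p = a ∧ q = a + 1
    · obtain ⟨rfl, rfl⟩ := hab
      exact ⟨b, List.sublist_cons_self _ _, rfl, by simp [← mul_assoc]⟩
    · have h' := swap_succ_lt hpq hab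
      obtain ⟨c, hc, hl, hw⟩ := ih h' (by simpa using h)
      refine ⟨a :: c, hc.cons_cons a, by simp [hl], ?_⟩
      rw [wordProd_cons, wordProd_cons, hw, swap_apply_apply]
      simp [mul_assoc]

/-- The exchange property at a descent. -/
theorem exists_sublist_mul_swap (b : List ℕ) {a : ℕ}
    (h : wordProd b (a + 1) < wordProd b a) :
    ∃ c, c.Sublist b ∧ c.length + 1 = b.length ∧ wordProd c = wordProd b * swap a (a + 1) := by
  obtain ⟨c, hc, hl, hw⟩ := exists_sublist_swap_mul b h (by simp)
  refine ⟨c, hc, hl, ?_⟩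
  rw [hw, swap_comm, swap_apply_apply]
  simp [mul_assoc]

/-- A permutation fixing every `i ≥ m`. -/
def FixesFrom (m : ℕ) (w : Perm ℕ) : Prop := ∀ i, m ≤ i → w i = i

theorem FixesFrom.lt_iff {m : ℕ} {w : Perm ℕ} (h : FixesFrom m w) (i : ℕ) : w i < m ↔ i < m := by
  constructor
  · intro hi
    by_contra hc
    rw [h i (by omega)] at hi
    exact hc hi
  · intro hi
    by_contra hc
    have := w.injective (h (w i) (by omega))
    omega

theorem fixesFrom_one (m : ℕ) : FixesFrom m 1 := fun _ _ => rfl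

theorem FixesFrom.mul {m : ℕ} {v w : Perm ℕ} (hv : FixesFrom m v) (hw : FixesFrom m w) :
    FixesFrom m (v * w) := fun i hi => by rw [Perm.mul_apply, hw i hi, hv i hi]

theorem FixesFrom.inv {m : ℕ} {w : Perm ℕ} (hw : FixesFrom m w) : FixesFrom m w⁻¹ :=
  fun i hi => by rw [Perm.inv_eq_iff_eq, hw i hi]

theorem fixesFrom_swap {m a : ℕ} (h : a + 1 < m) : FixesFrom m (swap a (a + 1)) :=
  fun i hi => swap_apply_of_ne_of_ne (by omega) (by omega)

theorem fixesFrom_wordProd {m : ℕ} {b : List ℕ} (h : ∀ a ∈ b, a + 1 < m) :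
    FixesFrom m (wordProd b) := by
  induction b with
  | nil => exact fixesFrom_one m
  | cons a b ih =>
    rw [wordProd_cons]
    exact (fixesFrom_swap (h a (by simp))).mul (ih fun c hc => h c (by simp [hc]))

theorem IsReducedWord.init {w : Perm ℕ} {b : List ℕ} {a : ℕ} (h : IsReducedWord w (b ++ [a])) :
    IsReducedWord (w * swap a (a + 1)) b := by
  refine ⟨by rw [← h.1, wordProd_concat]; simp [mul_assoc], fun c hc => ?_⟩
  have := h.2 (c ++ [a]) (by rw [wordProd_concat, hc]; simp [mul_assoc])
  simpa using this

/-- The last letter of a reduced word is a descent. -/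
theorem IsReducedWord.descent {w : Perm ℕ} {b : List ℕ} {a : ℕ}
    (h : IsReducedWord w (b ++ [a])) : w (a + 1) < w a := by
  by_contra hc
  have hne : w a ≠ w (a + 1) := fun h => by simpa using w.injective h
  have hb := h.init
  obtain ⟨c, -, hl, hw⟩ := exists_sublist_mul_swap b (a := a) (by
    rw [hb.1]; simp; omega)
  have := h.2 c (by rw [hw, hb.1]; simp [mul_assoc])
  simp at this
  omega

/-- A permutation fixing every i ≥ m has no descent reaching m, so peeling letters from the right
never leaves the permutations of [m]. -/
theorem IsReducedWord.lt_of_mem {m : ℕ} {w : Perm ℕ} {b : List ℕ} (h : IsReducedWord w b)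
    (hw : FixesFrom m w) : ∀ a ∈ b, a + 1 < m := by
  induction b using List.reverseRecOn generalizing w with
  | nil => simp
  | append_singleton b a ih =>
    have ha : a + 1 < m := by
      by_contra hc
      have hd := h.descent
      rw [hw (a + 1) (by omega)] at hd
      rcases Nat.lt_or_ge a m with ham | ham
      · have := (hw.lt_iff a).2 ham
        omega
      · rw [hw a ham] at hd
        omega
    intro c hc
    rcases List.mem_append.1 hc with hc | hc
    · exact ih h.init (hw.mul (fixesFrom_swap ha)) c hc
    · rw [List.mem_singleton.1 hc]
      exact ha

/-! ### Words for fixed-point-free involutions -/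

/-- The involution obtained from `(1, 2)(3, 4)(5, 6) ⋯` by conjugation with `wordProd b`. -/
def fpfConj (b : List ℕ) : Perm ℕ := (wordProd b)⁻¹ * pairsFrom 0 * wordProd b

/-- A word of shortest possible length among those with `fpfConj b = z`. -/
def IsReducedFPFWord (z : Perm ℕ) (b : List ℕ) : Prop :=
  fpfConj b = z ∧ ∀ c : List ℕ, fpfConj c = z → b.length ≤ c.length

theorem fpfConj_concat (b : List ℕ) (a : ℕ) :
    fpfConj (b ++ [a]) = swap a (a + 1) * fpfConj b * swap a (a + 1) := by
  simp [fpfConj, wordProd_concat, mul_assoc]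

theorem swap_conj_conj (a c : ℕ) (z : Perm ℕ) :
    swap a c * (swap a c * z * swap a c) * swap a c = z := by
  simp [mul_assoc, ← mul_assoc (swap a c) (swap a c)]

theorem pairsFrom_apply (a i : ℕ) :
    pairsFrom a i = if i < a then i else if Even (i - a) then i + 1 else i - 1 := rfl

theorem pairsFrom_pairsFrom (a i : ℕ) : pairsFrom a (pairsFrom a i) = i :=
  pairsFromFun_involutive a i

theorem pairsFrom_zero_ne (i : ℕ) : pairsFrom 0 i ≠ i := by
  rw [pairsFrom_apply]
  simp only [Nat.even_iff]
  split_ifs <;> omega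

/-- Reflections paired by a fixed-point-free involution commute. -/
theorem swap_conj_eq_of_fpf {t : Perm ℕ} (ht : ∀ i, t (t i) = i) (hf : ∀ i, t i ≠ i) (p q : ℕ) :
    swap p q * t * swap p q = swap (t p) (t q) * t * swap (t p) (t q) := by
  by_cases hpq : t p = q
  · subst hpq
    rw [ht, swap_comm]
  have hqp : t q ≠ p := fun h => hpq (by rw [← h, ht])
  have h1 : swap (t p) (t q) * t = t * swap p q := by
    rw [swap_apply_apply]; simp
  have h2 : swap p q * t = t * swap (t p) (t q) := by
    have h := swap_apply_apply t (t p) (t q)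
    rw [ht, ht] at h
    simp [h, mul_assoc]
  have hcomm : swap (t p) (t q) * swap p q = swap p q * swap (t p) (t q) := by
    by_cases h : p = q
    · subst h; simp
    have h' : t p ≠ t q := fun h' => h (t.injective h')
    apply Perm.Disjoint.commute
    intro i
    by_contra! hc
    obtain ⟨hi1, hi2⟩ := hc
    have h3 := (swap_apply_ne_self_iff.1 hi1).2
    have h4 := (swap_apply_ne_self_iff.1 hi2).2
    have := hf p
    have := hf q
    grind
  rw [h1, h2, mul_assoc, mul_assoc, hcomm]

/-- The exchange property for words of fixed-point-free involutions. -/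
theorem exists_sublist_fpfConj (b : List ℕ) {a : ℕ} (h : fpfConj b (a + 1) < fpfConj b a)
    (hne : fpfConj b a ≠ a + 1) :
    ∃ c, c.Sublist b ∧ c.length + 1 = b.length ∧
      fpfConj c = swap a (a + 1) * fpfConj b * swap a (a + 1) := by
  set A := wordProd b with hA
  rcases lt_or_ge (A (a + 1)) (A a) with hlt | hge
  · obtain ⟨c, hc, hl, hw⟩ := exists_sublist_mul_swap b hlt
    exact ⟨c, hc, hl, by simp [fpfConj, hw, mul_assoc]⟩
  · have hlt : A a < A (a + 1) := lt_of_le_of_ne hge fun h => by simpa using A.injective h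
    have hz : ∀ i, fpfConj b i = A⁻¹ (pairsFrom 0 (A i)) := fun i => rfl
    -- Here A has an ascent at a, so ordinary exchange fails. The pair (A a, A (a + 1)) is replaced
    -- by its image under Θ: both reflections conjugate Θ to the same element, Θ preserves the order
    -- of a pair that is not one of its cycles, and the descent of z says that A⁻¹ inverts the image
    -- pair.
    have hne' : pairsFrom 0 (A a) ≠ A (a + 1) := fun h => hne (by rw [hz, h]; simp)
    have hpq : pairsFrom 0 (A a) < pairsFrom 0 (A (a + 1)) := by
      revert hne'
      simp only [pairsFrom_apply, Nat.even_iff]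
      split_ifs <;> omega
    obtain ⟨c, hc, hl, hw⟩ := exists_sublist_swap_mul b hpq (by rw [← hA, ← hz, ← hz]; exact h)
    refine ⟨c, hc, hl, ?_⟩
    have key := swap_conj_eq_of_fpf (pairsFrom_pairsFrom 0) pairsFrom_zero_ne (A a) (A (a + 1))
    have hs : swap (A a) (A (a + 1)) = A * swap a (a + 1) * A⁻¹ := swap_apply_apply _ _ _
    calc fpfConj c = A⁻¹ * (swap (pairsFrom 0 (A a)) (pairsFrom 0 (A (a + 1))) * pairsFrom 0 *
          swap (pairsFrom 0 (A a)) (pairsFrom 0 (A (a + 1)))) * A := by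
            rw [fpfConj, hw, mul_inv_rev, swap_inv]; simp only [mul_assoc, ← hA]
      _ = _ := by rw [← key, hs, fpfConj, ← hA]; simp [mul_assoc]

theorem fpfConj_involutive (b : List ℕ) (i : ℕ) : fpfConj b (fpfConj b i) = i := by
  simp [fpfConj, pairsFrom_pairsFrom]

theorem fpfConj_ne (b : List ℕ) (i : ℕ) : fpfConj b i ≠ i := by
  intro h
  simp only [fpfConj, Perm.mul_apply, Perm.inv_eq_iff_eq] at h
  exact pairsFrom_zero_ne _ h

theorem IsReducedFPFWord.init {z : Perm ℕ} {b : List ℕ} {a : ℕ}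
    (h : IsReducedFPFWord z (b ++ [a])) :
    IsReducedFPFWord (swap a (a + 1) * z * swap a (a + 1)) b := by
  refine ⟨by rw [← h.1, fpfConj_concat, swap_conj_conj], fun c hc => ?_⟩
  have := h.2 (c ++ [a]) (by rw [fpfConj_concat, hc, swap_conj_conj])
  simpa using this

/-- The last letter of a reduced word is a descent that is not a cycle. -/
theorem IsReducedFPFWord.descent {z : Perm ℕ} {b : List ℕ} {a : ℕ}
    (h : IsReducedFPFWord z (b ++ [a])) : z (a + 1) < z a ∧ z a ≠ a + 1 := by
  have hb := h.init
  have hinv : ∀ i, z (z i) = i := h.1 ▸ fpfConj_involutive _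
  have hfpf : ∀ i, z i ≠ i := h.1 ▸ fpfConj_ne _
  have hne : z a ≠ a + 1 := by
    intro hz
    have hz' : z (a + 1) = a := by rw [← hz, hinv]
    -- Conjugating z by one of its own cycles changes nothing, so the last letter would be
    -- superfluous.
    have hs : swap a (a + 1) * z * swap a (a + 1) = z := by
      have := swap_apply_apply z a (a + 1)
      rw [hz, hz', swap_comm] at this
      nth_rw 1 [this]
      simp [mul_assoc]
    have := h.2 b (by rw [hb.1, hs])
    simp at this
  refine ⟨?_, hne⟩
  by_contra hc
  have hlt : z a < z (a + 1) := by
    have : z a ≠ z (a + 1) := fun h => by simpa using z.injective h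
    omega
  -- An ascent of z at a is a descent of the conjugate by s_a, so exchange in `b` would give a word
  -- for z two letters shorter than `b ++ [a]`.
  have hlt' := swap_succ_lt (a := a) hlt (fun h => hfpf _ h.1)
  have hne' : swap a (a + 1) (z (a + 1)) ≠ a + 1 := by
    intro h
    have : z (a + 1) = a := by
      apply (swap a (a + 1)).injective
      rw [h, swap_apply_left]
    exact hne (by rw [show z a = z (z (a + 1)) by rw [this], hinv])
  obtain ⟨c, -, hl, hw⟩ := exists_sublist_fpfConj b (a := a) (by rw [hb.1]; simpa using hlt')
    (by rw [hb.1]; simpa using hne')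
  have := h.2 c (by rw [hw, hb.1, swap_conj_conj])
  simp at this
  omega

/-- A permutation of the form `FPF_m(y)`, with `m` even and `y` fixed-point-free in `[m]`, is
equal to `(1, 2)(3, 4) ⋯` beyond `m`. -/
def PairsFrom (m : ℕ) (z : Perm ℕ) : Prop := ∀ i, m ≤ i → z i = pairsFrom m i

theorem PairsFrom.lt {m : ℕ} {z : Perm ℕ} (h : PairsFrom m z) {i : ℕ} (hi : i < m) : z i < m := by
  by_contra hc
  have hm : m ≤ pairsFrom m (z i) := by
    rw [pairsFrom_apply]
    simp only [Nat.even_iff]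
    split_ifs <;> omega
  have := z.injective ((h _ hm).trans (pairsFrom_pairsFrom m (z i)))
  omega

theorem PairsFrom.conj_swap {m a : ℕ} {z : Perm ℕ} (h : PairsFrom m z) (ha : a + 1 < m) :
    PairsFrom m (swap a (a + 1) * z * swap a (a + 1)) := by
  intro i hi
  have hm : m ≤ pairsFrom m i := by
    rw [pairsFrom_apply]
    simp only [Nat.even_iff]
    split_ifs <;> omega
  rw [Perm.mul_apply, Perm.mul_apply, fixesFrom_swap ha i hi, h i hi, fixesFrom_swap ha _ hm]

/-- Beyond m the only descents are the cycles (a, a + 1) themselves, and there is an ascent across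
the boundary between m - 1 and m. -/
theorem PairsFrom.lt_of_descent {m a : ℕ} {z : Perm ℕ} (h : PairsFrom m z)
    (ha : z (a + 1) < z a) (hne : z a ≠ a + 1) : a + 1 < m := by
  by_contra hc
  rcases Nat.lt_or_ge a m with ham | ham
  · have h1 := h.lt ham
    have h2 := h (a + 1) (by omega)
    rw [pairsFrom_apply] at h2
    simp only [Nat.even_iff] at h2
    split_ifs at h2 <;> omega
  · have h1 := h a ham
    have h2 := h (a + 1) (by omega)
    rw [pairsFrom_apply] at h1 h2
    simp only [Nat.even_iff] at h1 h2
    split_ifs at h1 h2 <;> omega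

theorem IsReducedFPFWord.lt_of_mem {m : ℕ} {z : Perm ℕ} {b : List ℕ} (h : IsReducedFPFWord z b)
    (hz : PairsFrom m z) : ∀ a ∈ b, a + 1 < m := by
  induction b using List.reverseRecOn generalizing z with
  | nil => simp
  | append_singleton b a ih =>
    have ha : a + 1 < m := hz.lt_of_descent h.descent.1 h.descent.2
    intro c hc
    rcases List.mem_append.1 hc with hc | hc
    · exact ih h.init (hz.conj_swap ha) c hc
    · rw [List.mem_singleton.1 hc]
      exact ha

/-- Deleting a letter from a reduced word lowers the involution along a shortening conjugation. -/
theorem IsReducedFPFWord.exists_sublist {z : Perm ℕ} {b c : List ℕ} {a : ℕ}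
    (h : IsReducedFPFWord z b) (hc : IsReducedFPFWord z (c ++ [a])) :
    ∃ d, d.Sublist b ∧ IsReducedFPFWord (swap a (a + 1) * z * swap a (a + 1)) d := by
  obtain ⟨d, hd, hl, hw⟩ := exists_sublist_fpfConj b (a := a) (by rw [h.1]; exact hc.descent.1)
    (by rw [h.1]; exact hc.descent.2)
  refine ⟨d, hd, by rw [hw, h.1], fun e he => ?_⟩
  have := h.2 (e ++ [a]) (by rw [fpfConj_concat, he, swap_conj_conj])
  simp at this
  omega

theorem IsReducedFPFWord.length_eq {z : Perm ℕ} {b c : List ℕ} (hb : IsReducedFPFWord z b)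
    (hc : IsReducedFPFWord z c) : b.length = c.length :=
  le_antisymm (hb.2 c hc.1) (hc.2 b hb.1)

theorem exists_isReducedFPFWord (b : List ℕ) : ∃ c, IsReducedFPFWord (fpfConj b) c := by
  classical
  have h : ∃ k, ∃ c : List ℕ, fpfConj c = fpfConj b ∧ c.length = k := ⟨_, b, rfl, rfl⟩
  obtain ⟨c, hc, hl⟩ := Nat.find_spec h
  exact ⟨c, hc, fun d hd => hl ▸ Nat.find_min' h ⟨d, hd, rfl⟩⟩

/-! ### Comparison of the two notions of length -/

theorem fpfStd_of_mem_fpfInvolutions {m : ℕ} {y : Perm ℕ} (hy : y ∈ fpfInvolutions m) :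
    fpfStd m y = y * pairsFrom m := by
  have h : fixedPointList m y = [] := by
    simp only [fixedPointList, List.filter_eq_nil_iff, List.mem_range, decide_eq_true_eq]
    exact hy.2
  simp [fpfStd, fixedPointMatching, h]

theorem FixesFrom.commute_pairsFrom {m : ℕ} {w : Perm ℕ} (h : FixesFrom m w) :
    w * pairsFrom m = pairsFrom m * w := by
  apply Perm.Disjoint.commute
  intro i
  rcases Nat.lt_or_ge i m with hi | hi
  · exact Or.inr (by rw [pairsFrom_apply, if_pos hi])
  · exact Or.inl (h i hi)

/-- Let i be the first point where y differs from Θ. Then i is even and y preserves the points ≥ i,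
so y i ≥ i + 2. The value i at position y i is smaller than the value just before it, which gives
the descent a = y i - 1. -/
theorem exists_descent_of_ne {m : ℕ} {y : Perm ℕ} (hm : Even m) (hy : y ∈ fpfInvolutions m)
    (hne : y * pairsFrom m ≠ pairsFrom 0) : ∃ a, a + 1 < m ∧ y (a + 1) < y a ∧ y a ≠ a + 1 := by
  classical
  obtain ⟨⟨hyy, hfix⟩, hf⟩ := hy
  have hinv : ∀ i, y (y i) = i := fun i => by rw [← Perm.mul_apply, hyy, Perm.one_apply]
  have hlt : ∀ i, y i < m ↔ i < m := FixesFrom.lt_iff hfix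
  have hex : ∃ i, i < m ∧ y i ≠ pairsFrom 0 i := by
    by_contra! hc
    apply hne
    ext i
    rw [Perm.mul_apply]
    rcases Nat.lt_or_ge i m with hi | hi
    · rw [pairsFrom_apply m, if_pos hi, hc i hi]
    · have hm' : m ≤ pairsFrom m i := by
        rw [pairsFrom_apply]
        simp only [Nat.even_iff]
        split_ifs <;> omega
      rw [hfix _ hm']
      simp only [pairsFrom_apply, Nat.even_iff] at *
      split_ifs <;> omega
  have hi := Nat.find_spec hex
  have hmin : ∀ j, j < Nat.find hex → y j = pairsFrom 0 j := by
    intro j hj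
    have := Nat.find_min hex hj
    push Not at this
    exact this (by omega)
  set i := Nat.find hex
  have hpair : ∀ j, pairsFrom 0 j = if j % 2 = 0 then j + 1 else j - 1 := by
    intro j
    rw [pairsFrom_apply]
    simp [Nat.even_iff]
  have hev : i % 2 = 0 := by
    by_contra hodd
    have h1 := hmin (i - 1) (by omega)
    rw [hpair, if_pos (by omega), Nat.sub_add_cancel (by omega)] at h1
    apply hi.2
    rw [hpair, if_neg hodd, ← h1, hinv, h1]
  have hge : ∀ j, i ≤ j → i ≤ y j := by
    intro j hj
    by_contra! hc
    have h1 := hmin _ hc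
    rw [hinv, hpair] at h1
    split_ifs at h1 <;> omega
  have h1 := hge i le_rfl
  have h2 := hf i hi.1
  have h3 := hi.2
  rw [hpair, if_pos hev] at h3
  have h4 := (hlt i).2 hi.1
  refine ⟨y i - 1, by omega, ?_, ?_⟩
  · rw [Nat.sub_add_cancel (by omega), hinv]
    refine lt_of_le_of_ne (hge _ (by omega)) fun h => ?_
    have := congrArg y h
    rw [hinv] at this
    omega
  · rw [Nat.sub_add_cancel (by omega)]
    intro h
    have := y.injective h
    omega

theorem fpfInvolutions_conj_swap {m a : ℕ} {y : Perm ℕ} (hy : y ∈ fpfInvolutions m)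
    (ha : a + 1 < m) : swap a (a + 1) * y * swap a (a + 1) ∈ fpfInvolutions m := by
  obtain ⟨⟨hyy, hfix⟩, hf⟩ := hy
  have hs : FixesFrom m (swap a (a + 1)) := fixesFrom_swap ha
  refine ⟨⟨?_, (hs.mul hfix).mul hs⟩, fun i hi h => ?_⟩
  · calc _ = swap a (a + 1) * (y * y) * swap a (a + 1) := by simp [mul_assoc]
      _ = 1 := by simp [hyy]
  · apply hf (swap a (a + 1) i) ((hs.lt_iff i).2 hi)
    apply (swap a (a + 1)).injective
    simpa using h

/-- Each letter a contributes at most the two points a, a + 1 to the support. -/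
theorem le_two_mul_length {m : ℕ} (b : List ℕ) (h : ∀ i, i < m → wordProd b i ≠ i) :
    m ≤ 2 * b.length := by
  classical
  have key : ∀ i, wordProd b i ≠ i → i ∈ b.toFinset ∪ b.toFinset.image (· + 1) := by
    clear h
    induction b with
    | nil => simp
    | cons a b ih =>
      intro i hi
      by_cases hb : wordProd b i = i
      · have : i = a ∨ i = a + 1 := by
          by_contra! hc
          exact hi (by rw [wordProd_cons, Perm.mul_apply, hb, swap_apply_of_ne_of_ne hc.1 hc.2])
        rcases this with rfl | rfl <;> simp
      · have := ih i hb
        simp only [Finset.mem_union, List.mem_toFinset, Finset.mem_image, List.mem_cons] at this ⊢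
        grind
  calc m = (Finset.range m).card := by simp
    _ ≤ (b.toFinset ∪ b.toFinset.image (· + 1)).card :=
        Finset.card_le_card fun i hi => key i (h i (Finset.mem_range.1 hi))
    _ ≤ b.toFinset.card + (b.toFinset.image (· + 1)).card := Finset.card_union_le _ _
    _ ≤ b.length + b.length :=
        add_le_add b.toFinset_card_le (Finset.card_image_le.trans b.toFinset_card_le)
    _ = 2 * b.length := by ring

/-- Every word for a fixed-point-free involution in `S_m` is at least as long as the palindromic
word built from some word of the corresponding fixed-point-free involution. -/
theorem exists_fpfConj_of_wordProd {m : ℕ} (hm : Even m) (b : List ℕ)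
    (hy : wordProd b ∈ fpfInvolutions m) :
    ∃ e, fpfConj e = wordProd b * pairsFrom m ∧ 2 * e.length + m / 2 ≤ b.length := by
  induction hk : b.length using Nat.strong_induction_on generalizing b with
  | _ k ih =>
    by_cases hz : wordProd b * pairsFrom m = pairsFrom 0
    · refine ⟨[], by simp [fpfConj, hz], ?_⟩
      have := le_two_mul_length b hy.2
      simp
      omega
    · obtain ⟨a, ha, hd, hne⟩ := exists_descent_of_ne hm hy hz
      obtain ⟨c, -, hcl, hcw⟩ := exists_sublist_mul_swap b hd
      have hyinv : (wordProd b)⁻¹ = wordProd b := inv_eq_of_mul_eq_one_left hy.1.1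
      -- The descent removes one letter on the right. Since y is its own inverse, reversing the word
      -- brings the other side of y to the right end; a is still a descent there because y does not
      -- exchange a and a + 1. Two letters of `b` are thus traded for one letter of `e`.
      have hc' : wordProd c.reverse = swap a (a + 1) * wordProd b := by
        rw [wordProd_reverse, hcw, mul_inv_rev, swap_inv, hyinv]
      have hinv : ∀ i, wordProd b (wordProd b i) = i := fun i => by
        rw [← Perm.mul_apply, hy.1.1, Perm.one_apply]
      obtain ⟨d, -, hdl, hdw⟩ := exists_sublist_mul_swap c.reverse (a := a) (by
        rw [hc']
        refine swap_succ_lt hd fun h => hne h.2)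
      rw [hc'] at hdw
      rw [List.length_reverse] at hdl
      obtain ⟨e, he, hel⟩ := ih d.length (by omega) d
        (hdw ▸ fpfInvolutions_conj_swap hy ha) rfl
      refine ⟨e ++ [a], ?_, by simp; omega⟩
      rw [fpfConj_concat, he, hdw, mul_assoc _ _ (pairsFrom m),
        (fixesFrom_swap ha).commute_pairsFrom]
      simp [mul_assoc]

/-! ### Reading words -/

theorem readingKey_apply (p : ℕ × ℕ) : readingKey p = toLex (p.1, OrderDual.toDual p.2) := rfl

theorem readingKey_lt {p q : ℕ × ℕ} :
    readingKey p < readingKey q ↔ p.1 < q.1 ∨ p.1 = q.1 ∧ q.2 < p.2 := by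
  simp [readingKey_apply, Prod.Lex.toLex_lt_toLex]

theorem readingWord_length (D : Finset (ℕ × ℕ)) : (readingWord D).length = D.card := by
  simp [readingWord]

theorem mem_readingWord {D : Finset (ℕ × ℕ)} {a : ℕ} :
    a ∈ readingWord D ↔ ∃ p ∈ D, p.1 + p.2 = a := by
  simp [readingWord, readingKey_apply]

@[simp] theorem readingWord_empty : readingWord ∅ = [] := by simp [readingWord]

@[simp] theorem readingWord_singleton (p : ℕ × ℕ) : readingWord {p} = [p.1 + p.2] := by
  simp [readingWord, readingKey_apply]

theorem readingWord_union {A B : Finset (ℕ × ℕ)}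
    (h : ∀ a ∈ A, ∀ b ∈ B, readingKey a < readingKey b) :
    readingWord (A ∪ B) = readingWord A ++ readingWord B := by
  classical
  have key : ((A ∪ B).map readingKey).sort (· ≤ ·) =
      (A.map readingKey).sort (· ≤ ·) ++ (B.map readingKey).sort (· ≤ ·) := by
    have hlt : ∀ a ∈ (A.map readingKey).sort (· ≤ ·), ∀ b ∈ (B.map readingKey).sort (· ≤ ·),
        a < b := by
      intro a ha b hb
      simp only [Finset.mem_sort, Finset.mem_map] at ha hb
      obtain ⟨a, ha, rfl⟩ := ha
      obtain ⟨b, hb, rfl⟩ := hb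
      exact h a ha b hb
    have hnd : ((A.map readingKey).sort (· ≤ ·) ++ (B.map readingKey).sort (· ≤ ·)).Nodup :=
      List.Nodup.append (Finset.sort_nodup _ _) (Finset.sort_nodup _ _)
        fun x hx hx' => lt_irrefl x (hlt x hx x hx')
    rw [← (List.toFinset_sort (· ≤ ·) hnd).2]
    · congr 1
      ext x
      simp [Finset.map_union]
    · exact List.pairwise_append.2 ⟨Finset.pairwise_sort _ _, Finset.pairwise_sort _ _,
        fun a ha b hb => (hlt a ha b hb).le⟩
  simp [readingWord, key]

/-- Carries the exchange property from words to sets of positions: a sublist of the word comes from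
a sublist of the sorted positions, which is again sorted. -/
theorem exists_subset_of_sublist {D : Finset (ℕ × ℕ)} {c : List ℕ}
    (h : c.Sublist (readingWord D)) : ∃ E ⊆ D, readingWord E = c := by
  classical
  obtain ⟨l, hl, rfl⟩ := List.sublist_map_iff.1 h
  have hnd : l.Nodup := (Finset.sort_nodup _ _).sublist hl
  have hmap : (D.filter fun p => readingKey p ∈ l).map readingKey = l.toFinset := by
    ext q
    simp only [Finset.mem_map, Finset.mem_filter, List.mem_toFinset]
    constructor
    · rintro ⟨p, ⟨-, hp⟩, rfl⟩
      exact hp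
    · intro hq
      have := hl.subset hq
      simp only [Finset.mem_sort, Finset.mem_map] at this
      obtain ⟨p, hp, rfl⟩ := this
      exact ⟨p, ⟨hp, hq⟩, rfl⟩
  refine ⟨D.filter fun p => readingKey p ∈ l, Finset.filter_subset _ _, ?_⟩
  rw [readingWord, hmap, (List.toFinset_sort (· ≤ ·) hnd).2]
  exact (Finset.pairwise_sort _ _).sublist hl

theorem readingWord_insert_max {D : Finset (ℕ × ℕ)} {p : ℕ × ℕ}
    (h : ∀ q ∈ D, readingKey q < readingKey p) :
    readingWord (insert p D) = readingWord D ++ [p.1 + p.2] := by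
  rw [← readingWord_singleton, ← readingWord_union (by simpa using h)]
  congr 1
  ext
  simp

@[elab_as_elim]
theorem induction_on_readingKey {P : Finset (ℕ × ℕ) → Prop} (E : Finset (ℕ × ℕ)) (empty : P ∅)
    (insert : ∀ p E, (∀ q ∈ E, readingKey q < readingKey p) → P E → P (insert p E)) : P E :=
  Finset.induction_on_max_value readingKey E empty fun p E hp hmax ih =>
    insert p E (fun q hq => lt_of_le_of_ne (hmax q hq) fun h => hp (readingKey.injective h ▸ hq)) ih

theorem commute_wordProd {b : List ℕ} {a : ℕ} (h : ∀ c ∈ b, c + 2 ≤ a ∨ a + 2 ≤ c) :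
    Commute (swap a (a + 1)) (wordProd b) := by
  induction b with
  | nil => exact Commute.one_right _
  | cons c b ih =>
    rw [wordProd_cons]
    refine Commute.mul_right ?_ (ih fun d hd => h d (by simp [hd]))
    apply Perm.Disjoint.commute
    intro i
    have := h c (by simp)
    by_contra! hc
    have h1 := (swap_apply_ne_self_iff.1 hc.1).2
    have h2 := (swap_apply_ne_self_iff.1 hc.2).2
    omega

theorem readingWord_insert {D : Finset (ℕ × ℕ)} {p : ℕ × ℕ} (hp : p ∉ D) :
    readingWord (insert p D) = readingWord (D.filter fun q => readingKey q < readingKey p) ++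
      [p.1 + p.2] ++ readingWord (D.filter fun q => readingKey p < readingKey q) := by
  rw [← readingWord_insert_max (by simp), ← readingWord_union]
  · congr 1
    ext q
    simp only [Finset.mem_insert, Finset.mem_union, Finset.mem_filter]
    have : q ∈ D → readingKey q < readingKey p ∨ readingKey p < readingKey q := fun hq =>
      lt_or_gt_of_ne fun h => hp (readingKey.injective h ▸ hq)
    tauto
  · intro a ha b hb
    simp only [Finset.mem_insert, Finset.mem_filter] at ha hb
    rcases ha with rfl | ha
    · exact hb.2
    · exact ha.2.trans hb.2

theorem readingWord_filter_append {D : Finset (ℕ × ℕ)} {p : ℕ × ℕ} (hp : p ∉ D) :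
    readingWord D = readingWord (D.filter fun q => readingKey q < readingKey p) ++
      readingWord (D.filter fun q => readingKey p < readingKey q) := by
  rw [← readingWord_union]
  · congr 1
    ext q
    simp only [Finset.mem_union, Finset.mem_filter]
    have : q ∈ D → readingKey q < readingKey p ∨ readingKey p < readingKey q := fun hq =>
      lt_or_gt_of_ne fun h => hp (readingKey.injective h ▸ hq)
    tauto
  · intro a ha b hb
    simp only [Finset.mem_filter] at ha hb
    exact ha.2.trans hb.2

/-- Inserting a position whose letter commutes with all letters read after it. -/
theorem wordProd_insert_right {D : Finset (ℕ × ℕ)} {p : ℕ × ℕ} (hp : p ∉ D)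
    (h : ∀ q ∈ D, readingKey p < readingKey q →
      q.1 + q.2 + 2 ≤ p.1 + p.2 ∨ p.1 + p.2 + 2 ≤ q.1 + q.2) :
    wordProd (readingWord (insert p D)) =
      wordProd (readingWord D) * swap (p.1 + p.2) (p.1 + p.2 + 1) := by
  rw [readingWord_insert hp, readingWord_filter_append hp, wordProd_append, wordProd_concat,
    wordProd_append, mul_assoc, mul_assoc]
  congr 1
  refine (commute_wordProd ?_).eq
  intro c hc
  obtain ⟨q, hq, rfl⟩ := mem_readingWord.1 hc
  exact h q (Finset.mem_filter.1 hq).1 (Finset.mem_filter.1 hq).2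

/-- Inserting a position whose letter commutes with all letters read before it. -/
theorem wordProd_insert_left {D : Finset (ℕ × ℕ)} {p : ℕ × ℕ} (hp : p ∉ D)
    (h : ∀ q ∈ D, readingKey q < readingKey p →
      q.1 + q.2 + 2 ≤ p.1 + p.2 ∨ p.1 + p.2 + 2 ≤ q.1 + q.2) :
    wordProd (readingWord (insert p D)) =
      swap (p.1 + p.2) (p.1 + p.2 + 1) * wordProd (readingWord D) := by
  rw [readingWord_insert hp, readingWord_filter_append hp, wordProd_append, wordProd_concat,
    wordProd_append, ← mul_assoc]
  congr 1
  refine (commute_wordProd ?_).eq.symm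
  intro c hc
  obtain ⟨q, hq, rfl⟩ := mem_readingWord.1 hc
  exact h q (Finset.mem_filter.1 hq).1 (Finset.mem_filter.1 hq).2

/-! ### Symmetric pipe dreams -/

/-- The diagonal positions indexed by `K`. -/
def diagonal (K : Finset ℕ) : Finset (ℕ × ℕ) := K.image fun k => (k, k)

/-- The symmetric set with strictly lower triangular part `E` and diagonal part `K`. -/
def symmetrize (E : Finset (ℕ × ℕ)) (K : Finset ℕ) : Finset (ℕ × ℕ) :=
  E ∪ E.image Prod.swap ∪ diagonal K

theorem mem_symmetrize {E : Finset (ℕ × ℕ)} {K : Finset ℕ} {p : ℕ × ℕ} :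
    p ∈ symmetrize E K ↔ p ∈ E ∨ (p.2, p.1) ∈ E ∨ p.1 = p.2 ∧ p.1 ∈ K := by
  obtain ⟨i, j⟩ := p
  simp only [symmetrize, diagonal, Finset.mem_union, Finset.mem_image, Prod.mk.injEq, Prod.exists,
    Prod.swap_prod_mk]
  constructor
  · rintro ((h | ⟨a, b, h, rfl, rfl⟩) | ⟨k, h, rfl, rfl⟩)
    · exact Or.inl h
    · exact Or.inr (Or.inl h)
    · exact Or.inr (Or.inr ⟨rfl, h⟩)
  · rintro (h | h | ⟨rfl, h⟩)
    · exact Or.inl (Or.inl h)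
    · exact Or.inl (Or.inr ⟨_, _, h, rfl, rfl⟩)
    · exact Or.inr ⟨_, h, rfl, rfl⟩

theorem card_symmetrize {E : Finset (ℕ × ℕ)} (hE : ∀ p ∈ E, p.2 < p.1) (K : Finset ℕ) :
    (symmetrize E K).card = 2 * E.card + K.card := by
  rw [symmetrize, diagonal, Finset.card_union_of_disjoint, Finset.card_union_of_disjoint,
    Finset.card_image_of_injective _ Prod.swap_injective,
    Finset.card_image_of_injective _ fun a b h => (Prod.mk.inj h).1]
  · ring
  · rw [Finset.disjoint_left]
    rintro p hp hp'
    obtain ⟨q, hq, rfl⟩ := Finset.mem_image.1 hp'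
    have h1 := hE _ hp
    have h2 := hE _ hq
    simp at h1
    omega
  · rw [Finset.disjoint_left]
    rintro p hp hp'
    obtain ⟨k, hk, rfl⟩ := Finset.mem_image.1 hp'
    rcases Finset.mem_union.1 hp with hp | hp
    · exact lt_irrefl _ (hE _ hp)
    · obtain ⟨q, hq, hqk⟩ := Finset.mem_image.1 hp
      have h2 := hE _ hq
      simp only [Prod.swap, Prod.mk.injEq] at hqk
      omega

/-- The word of a symmetric set is a palindrome up to commutations. -/
theorem wordProd_symmetrize {E : Finset (ℕ × ℕ)} (hE : ∀ p ∈ E, p.2 < p.1) (K : Finset ℕ) :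
    wordProd (readingWord (symmetrize E K)) =
      (wordProd (readingWord E))⁻¹ * wordProd (readingWord (diagonal K)) *
        wordProd (readingWord E) := by
  induction E using induction_on_readingKey with
  | empty => simp [symmetrize]
  | insert p E hlt ih =>
    have hp : p ∉ E := fun h => lt_irrefl _ (hlt p h)
    have hEE : ∀ q ∈ E, q.2 < q.1 := fun q hq => hE q (Finset.mem_insert_of_mem hq)
    have hpp : p.2 < p.1 := hE p (Finset.mem_insert_self _ _)
    have hstep : symmetrize (insert p E) K = insert p (insert (p.2, p.1) (symmetrize E K)) := by
      ext q
      simp only [mem_symmetrize, Finset.mem_insert, Prod.ext_iff]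
      tauto
    have hl : (p.2, p.1) ∉ symmetrize E K := by
      rw [mem_symmetrize]
      rintro (h | h | h)
      · have := hEE _ h
        simp at this
        omega
      · exact hp h
      · simp at h
        omega
    have hr : p ∉ insert (p.2, p.1) (symmetrize E K) := by
      rw [Finset.mem_insert, mem_symmetrize]
      rintro (h | h | h | h)
      · rw [Prod.ext_iff] at h
        simp at h
        omega
      · exact hp h
      · have := hEE _ h
        simp at this
        omega
      · omega
    -- Let p = (i, j) be the last position of E. Only diagonal positions (k, k) with k > i are read
    -- after p, and everything read before (j, i) has letter at most i + j - 2. So the two new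
    -- letters can be moved to the two ends of the word.
    rw [hstep, wordProd_insert_right hr, wordProd_insert_left hl, ih hEE,
      readingWord_insert_max hlt, wordProd_concat, mul_inv_rev, swap_inv]
    · simp [mul_assoc, add_comm]
    · intro q hq hqp
      rw [readingKey_lt] at hqp
      rcases mem_symmetrize.1 hq with h | h | h
      · have h1 := readingKey_lt.1 (hlt _ h)
        have h2 := hEE _ h
        simp only at *
        omega
      · have h1 := readingKey_lt.1 (hlt _ h)
        have h2 := hEE _ h
        simp only at *
        omega
      · simp only at *
        omega
    · intro q hq hqp
      rw [readingKey_lt] at hqp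
      rcases Finset.mem_insert.1 hq with rfl | hq
      · simp only at *
        omega
      rcases mem_symmetrize.1 hq with h | h | h
      · have h1 := readingKey_lt.1 (hlt _ h)
        omega
      · have h1 := readingKey_lt.1 (hlt _ h)
        have h2 := hEE _ h
        simp only at *
        omega
      · omega

/-- With indices from 0, the position (k, k) has letter 2k, whose transposition is the cycle (2k, 2k
+ 1) of Θ; these cycles are disjoint. -/
theorem wordProd_diagonal_apply (K : Finset ℕ) (i : ℕ) :
    wordProd (readingWord (diagonal K)) i = if i / 2 ∈ K then pairsFrom 0 i else i := by
  induction K using Finset.induction_on_max generalizing i with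
  | empty => simp [diagonal]
  | insert k K hk ih =>
    have hkK : k ∉ K := fun h => lt_irrefl _ (hk k h)
    have : diagonal (insert k K) = insert (k, k) (diagonal K) := by simp [diagonal]
    rw [this, readingWord_insert_max, wordProd_concat, Perm.mul_apply]
    · have hp : ∀ j, pairsFrom 0 j = if j % 2 = 0 then j + 1 else j - 1 := by
        intro j
        rw [pairsFrom_apply]
        simp [Nat.even_iff]
      have hl : (k + k) / 2 = k := by omega
      have hr : (k + k + 1) / 2 = k := by omega
      dsimp only
      by_cases h1 : i = k + k
      · subst h1
        rw [swap_apply_left, ih, hr, if_neg hkK, hl, if_pos (Finset.mem_insert_self _ _), hp,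
          if_pos (by omega)]
      by_cases h2 : i = k + k + 1
      · subst h2
        rw [swap_apply_right, ih, hl, if_neg hkK, hr, if_pos (Finset.mem_insert_self _ _), hp,
          if_neg (by omega), Nat.add_sub_cancel]
      rw [swap_apply_of_ne_of_ne h1 h2, ih]
      have h3 : i / 2 ≠ k := by omega
      simp [h3]
    · intro q hq
      obtain ⟨j, hj, rfl⟩ := Finset.mem_image.1 hq
      exact readingKey_lt.2 (Or.inl (hk j hj))

theorem wordProd_diagonal_mul_pairsFrom {m : ℕ} (hm : Even m) :
    wordProd (readingWord (diagonal (Finset.range (m / 2)))) * pairsFrom m = pairsFrom 0 := by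
  ext i
  rw [Perm.mul_apply, wordProd_diagonal_apply]
  simp only [pairsFrom_apply, Finset.mem_range, Nat.even_iff] at *
  split_ifs <;> omega

/-- A word in letters below m - 1 commutes with the tail of Θ beyond m, so only the cycles of Θ
inside [m] are conjugated. -/
theorem fpfConj_eq_mul_pairsFrom {m : ℕ} (hm : Even m) {b : List ℕ} (hb : ∀ a ∈ b, a + 1 < m) :
    fpfConj b = (wordProd b)⁻¹ * wordProd (readingWord (diagonal (Finset.range (m / 2)))) *
      wordProd b * pairsFrom m := by
  rw [fpfConj, ← wordProd_diagonal_mul_pairsFrom hm, mul_assoc _ (wordProd b),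
    (fixesFrom_wordProd hb).commute_pairsFrom]
  simp [mul_assoc]

theorem pairsFrom_fpfStd {m : ℕ} {y : Perm ℕ} (hy : y ∈ fpfInvolutions m) :
    PairsFrom m (y * pairsFrom m) := by
  intro i hi
  rw [Perm.mul_apply]
  apply hy.1.2
  rw [pairsFrom_apply]
  simp only [Nat.even_iff]
  split_ifs <;> omega

/-- A shorter word for the conjugate of Θ would produce a shorter palindromic word for y. -/
theorem isReducedFPFWord_of_pipeDream {m : ℕ} (hm : Even m) {y : Perm ℕ}
    (hy : y ∈ fpfInvolutions m) {E : Finset (ℕ × ℕ)} (hE : ∀ p ∈ E, p.2 < p.1) {K : Finset ℕ}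
    (hD : symmetrize E K ∈ pipeDreams y) :
    IsReducedFPFWord (y * pairsFrom m) (readingWord E) := by
  have hlt := IsReducedWord.lt_of_mem hD hy.1.2
  have hElt : ∀ a ∈ readingWord E, a + 1 < m := by
    intro a ha
    obtain ⟨p, hp, rfl⟩ := mem_readingWord.1 ha
    exact hlt _ (mem_readingWord.2 ⟨p, mem_symmetrize.2 (Or.inl hp), rfl⟩)
  have hA := fixesFrom_wordProd hElt
  have hyA := (wordProd_symmetrize hE K).symm.trans hD.1
  have hK : K = Finset.range (m / 2) := by
    ext k
    rw [Finset.mem_range]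
    constructor
    · intro hk
      have := hlt _ (mem_readingWord.2
        ⟨(k, k), mem_symmetrize.2 (Or.inr (Or.inr ⟨rfl, hk⟩)), rfl⟩)
      simp only at this
      omega
    · intro hk
      by_contra hc
      -- If k were missing from `K`, the diagonal product would fix 2k, and its preimage would be a
      -- fixed point of y in [m].
      have h1 : (wordProd (readingWord E))⁻¹ (2 * k) < m := (hA.inv.lt_iff _).2 (by omega)
      apply hy.2 _ h1
      rw [← hyA]
      simp [Perm.mul_apply, wordProd_diagonal_apply, hc]
  subst hK
  have hconj : fpfConj (readingWord E) = y * pairsFrom m := by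
    rw [fpfConj_eq_mul_pairsFrom hm hElt, hyA]
  refine ⟨hconj, fun c hc => ?_⟩
  -- The letters of `c` may be large; a reduced replacement has all letters below m - 1, so the tail
  -- of Θ can be split off.
  obtain ⟨b, hb⟩ := exists_isReducedFPFWord c
  rw [hc] at hb
  have hblt := hb.lt_of_mem (pairsFrom_fpfStd hy)
  have hyb := hb.1
  rw [fpfConj_eq_mul_pairsFrom hm hblt] at hyb
  have hyb' := mul_right_cancel hyb
  have h1 := hD.2 (b.reverse ++ readingWord (diagonal (Finset.range (m / 2))) ++ b) (by
    rw [wordProd_append, wordProd_append, wordProd_reverse, hyb'])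
  have h2 := hb.2 c hc
  simp only [readingWord_length, card_symmetrize hE, List.length_append, List.length_reverse,
    diagonal, Finset.card_image_of_injective _ fun (a b : ℕ) (h : (a, a) = (b, b)) =>
    (Prod.mk.inj h).1] at h1 ⊢
  omega

theorem pipeDream_of_isReducedFPFWord {z : Perm ℕ} {E : Finset (ℕ × ℕ)}
    (hE : ∀ p ∈ E, p.2 < p.1) (h : IsReducedFPFWord z (readingWord E)) :
    ∃ m, Even m ∧ ∃ y ∈ fpfInvolutions m, y * pairsFrom m = z ∧
      symmetrize E (Finset.range (m / 2)) ∈ pipeDreams y := by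
  -- Any even m exceeding every letter by at least 2 serves.
  obtain ⟨n, hn⟩ : ∃ n, ∀ a ∈ readingWord E, a < n :=
    ⟨(readingWord E).sum + 1, fun a ha => Nat.lt_succ_of_le (List.le_sum_of_mem ha)⟩
  have hm : Even (2 * (n + 1)) := even_two_mul _
  set m := 2 * (n + 1) with hmdef
  have hElt : ∀ a ∈ readingWord E, a + 1 < m := fun a ha => by have := hn a ha; omega
  have hA := fixesFrom_wordProd hElt
  set θ := wordProd (readingWord (diagonal (Finset.range (m / 2)))) with hθ
  have hz := h.1
  rw [fpfConj_eq_mul_pairsFrom hm hElt] at hz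
  have hθ1 : ∀ i, i < m → θ i = pairsFrom 0 i := fun i hi => by
    rw [hθ, wordProd_diagonal_apply, if_pos (Finset.mem_range.2 (by omega))]
  have hθ2 : FixesFrom m θ := fun i hi => by
    rw [hθ, wordProd_diagonal_apply, if_neg (by rw [Finset.mem_range]; omega)]
  have hθθ : θ * θ = 1 := by
    ext i
    rw [Perm.mul_apply, Perm.one_apply]
    rcases Nat.lt_or_ge i m with hi | hi
    · have := (hθ2.lt_iff i).2 hi
      rw [hθ1 _ this, hθ1 _ hi, pairsFrom_pairsFrom]
    · rw [hθ2 i hi, hθ2 i hi]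
  set A := wordProd (readingWord E) with hAdef
  have hy : A⁻¹ * θ * A ∈ fpfInvolutions m := by
    refine ⟨⟨?_, (hA.inv.mul hθ2).mul hA⟩, fun i hi hfix => ?_⟩
    · calc _ = A⁻¹ * (θ * θ) * A := by simp [mul_assoc]
        _ = 1 := by simp [hθθ]
    · rw [Perm.mul_apply, Perm.mul_apply, Perm.inv_eq_iff_eq, hθ1 _ ((hA.lt_iff i).2 hi)] at hfix
      exact pairsFrom_zero_ne _ hfix
  refine ⟨m, hm, A⁻¹ * θ * A, hy, hz, wordProd_symmetrize hE _, fun b hb => ?_⟩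
  rw [← hb] at hy hz
  obtain ⟨e, he, hel⟩ := exists_fpfConj_of_wordProd hm b hy
  have := h.2 e (he.trans hz)
  simp only [readingWord_length, card_symmetrize hE, Finset.card_range] at this ⊢
  omega

theorem symmetrize_filter {D : Finset (ℕ × ℕ)} (hD : D.image Prod.swap = D) :
    symmetrize (D.filter fun p => p.2 < p.1) ((D.filter fun p => p.1 = p.2).image Prod.fst) =
      D := by
  have hs : ∀ i j, (i, j) ∈ D → (j, i) ∈ D := fun i j h => by
    rw [← hD]
    exact Finset.mem_image.2 ⟨_, h, rfl⟩
  ext ⟨i, j⟩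
  simp only [mem_symmetrize, Finset.mem_filter, Finset.mem_image, Prod.exists]
  constructor
  · rintro (h | h | ⟨rfl, a, b, ⟨h, rfl⟩, rfl⟩)
    · exact h.1
    · exact hs _ _ h.1
    · exact h
  · intro h
    rcases lt_trichotomy i j with hij | rfl | hij
    · exact Or.inr (Or.inl ⟨hs _ _ h, hij⟩)
    · exact Or.inr (Or.inr ⟨rfl, i, i, ⟨h, rfl⟩, rfl⟩)
    · exact Or.inl ⟨h, hij⟩

/-- The fpf-involution pipe dreams are the strictly lower triangular sets whose reading word is a
reduced word in the sense of `IsReducedFPFWord`. -/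
theorem mem_fpfPipeDreams {z : Perm ℕ} {E : Finset (ℕ × ℕ)} :
    E ∈ fpfPipeDreams z ↔ (∀ p ∈ E, p.2 < p.1) ∧ IsReducedFPFWord z (readingWord E) := by
  constructor
  · rintro ⟨m, hm, y, hy, rfl, D, hD, hDs, rfl⟩
    rw [fpfStd_of_mem_fpfInvolutions hy]
    have hE : ∀ p ∈ D.filter (fun p => p.2 < p.1), p.2 < p.1 := fun p hp =>
      (Finset.mem_filter.1 hp).2
    rw [← symmetrize_filter hDs] at hD
    exact ⟨hE, isReducedFPFWord_of_pipeDream hm hy hE hD⟩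
  · rintro ⟨hE, h⟩
    obtain ⟨m, hm, y, hy, hz, hD⟩ := pipeDream_of_isReducedFPFWord hE h
    refine ⟨m, hm, y, hy, by rw [fpfStd_of_mem_fpfInvolutions hy, hz], _, hD, ?_, ?_⟩
    · ext ⟨i, j⟩
      simp only [Finset.mem_image, mem_symmetrize, Prod.exists, Prod.swap_prod_mk, Prod.mk.injEq]
      constructor
      · rintro ⟨a, b, h, rfl, rfl⟩
        grind
      · intro h
        exact ⟨j, i, by grind, rfl, rfl⟩
    · ext p
      simp only [Finset.mem_filter, mem_symmetrize]
      constructor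
      · intro hp
        exact ⟨Or.inl hp, hE p hp⟩
      · rintro ⟨h | h | h, hlt⟩
        · exact h
        · have := hE _ h
          simp at this
          omega
        · omega

/-! ### Vertex-decomposability -/

theorem fpfPipeDreams_card_eq {z : Perm ℕ} {E E' : Finset (ℕ × ℕ)} (h : E ∈ fpfPipeDreams z)
    (h' : E' ∈ fpfPipeDreams z) : E.card = E'.card := by
  rw [← readingWord_length, ← readingWord_length]
  exact (mem_fpfPipeDreams.1 h).2.length_eq (mem_fpfPipeDreams.1 h').2

/-- Facets are the complements in Q of pipe dreams, all of which have the length of a reduced word.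
-/
theorem subwordComplex_isPure (z : Perm ℕ) (Q : Finset (ℕ × ℕ)) :
    (subwordComplex z Q).IsPure := by
  have key : ∀ F, (subwordComplex z Q).IsFacet F → ∃ E ∈ fpfPipeDreams z, E ⊆ Q ∧ F = Q \ E := by
    rintro F ⟨⟨hFQ, E, hE, hEF⟩, hmax⟩
    have hEQ : E ⊆ Q := hEF.trans Finset.sdiff_subset
    refine ⟨E, hE, hEQ, hmax _ ⟨Finset.sdiff_subset, E, hE, ?_⟩ ?_⟩
    · rw [Finset.sdiff_sdiff_eq_self hEQ]
    · intro x hx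
      exact Finset.mem_sdiff.2 ⟨hFQ hx, fun h => (Finset.mem_sdiff.1 (hEF h)).2 hx⟩
  intro F G hF hG
  obtain ⟨E, hE, hEQ, rfl⟩ := key F hF
  obtain ⟨E', hE', hEQ', rfl⟩ := key G hG
  rw [Finset.card_sdiff_of_subset hEQ, Finset.card_sdiff_of_subset hEQ',
    fpfPipeDreams_card_eq hE hE']

theorem Complex.ext_faces {α : Type*} {Δ Γ : Complex α} (hv : Δ.vertices = Γ.vertices)
    (hf : ∀ S, S ∈ Δ.faces ↔ S ∈ Γ.faces) : Δ = Γ := by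
  cases Δ
  cases Γ
  simp only [Complex.mk.injEq]
  exact ⟨hv, Set.ext hf⟩

theorem subwordComplex_link (z : Perm ℕ) {Q : Finset (ℕ × ℕ)} {q : ℕ × ℕ} (hq : q ∈ Q) :
    (subwordComplex z Q).link {q} = subwordComplex z (Q \ {q}) := by
  refine Complex.ext_faces rfl fun S => ?_
  constructor
  · rintro ⟨⟨hSQ, -⟩, hSq, -, E, hE, hEU⟩
    refine ⟨Finset.subset_sdiff.2 ⟨hSQ, Finset.disjoint_iff_inter_eq_empty.2 hSq⟩, E, hE, ?_⟩
    rwa [sdiff_sdiff, Finset.sup_eq_union, Finset.union_comm]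
  · rintro ⟨hSQ, E, hE, hEU⟩
    obtain ⟨hSQ', hSq⟩ := Finset.subset_sdiff.1 hSQ
    rw [sdiff_sdiff, Finset.sup_eq_union, Finset.union_comm] at hEU
    refine ⟨⟨hSQ', E, hE, hEU.trans (Finset.sdiff_subset_sdiff subset_rfl
      Finset.subset_union_left)⟩, Finset.disjoint_iff_inter_eq_empty.1 hSq,
      Finset.union_subset hSQ' (by simpa using hq), E, hE, hEU⟩

/-- Deletion of the last position when no pipe dream inside `Q` uses it. -/
theorem subwordComplex_deletion_of_notMem (z : Perm ℕ) {Q : Finset (ℕ × ℕ)} {q : ℕ × ℕ}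
    (h : ∀ E ∈ fpfPipeDreams z, E ⊆ Q → q ∉ E) :
    (subwordComplex z Q).deletion {q} = subwordComplex z (Q \ {q}) := by
  refine Complex.ext_faces rfl fun S => ?_
  constructor
  · rintro ⟨⟨hSQ, E, hE, hES⟩, hSq⟩
    refine ⟨Finset.subset_sdiff.2 ⟨hSQ, Finset.disjoint_iff_inter_eq_empty.2 hSq⟩, E, hE, ?_⟩
    intro p hp
    have hpq : p ≠ q := fun hpq => h E hE (hES.trans Finset.sdiff_subset) (hpq ▸ hp)
    have := Finset.mem_sdiff.1 (hES hp)
    simp [hpq, this]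
  · rintro ⟨hSQ, E, hE, hES⟩
    obtain ⟨hSQ', hSq⟩ := Finset.subset_sdiff.1 hSQ
    exact ⟨⟨hSQ', E, hE, hES.trans (Finset.sdiff_subset_sdiff Finset.sdiff_subset subset_rfl)⟩,
      Finset.disjoint_iff_inter_eq_empty.1 hSq⟩

/-- Deletion of the last position when some pipe dream inside `Q` uses it. -/
theorem subwordComplex_deletion_of_mem (z : Perm ℕ) {Q : Finset (ℕ × ℕ)} {q : ℕ × ℕ}
    (hmax : ∀ p ∈ Q, readingKey p ≤ readingKey q) {E₀ : Finset (ℕ × ℕ)}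
    (hE₀ : E₀ ∈ fpfPipeDreams z) (hEQ : E₀ ⊆ Q) (hqE : q ∈ E₀) :
    (subwordComplex z Q).deletion {q} = subwordComplex
      (swap (q.1 + q.2) (q.1 + q.2 + 1) * z * swap (q.1 + q.2) (q.1 + q.2 + 1)) (Q \ {q}) := by
  have hlast : ∀ E ⊆ Q, q ∉ E → readingWord (insert q E) = readingWord E ++ [q.1 + q.2] :=
    fun E hE hq => readingWord_insert_max fun p hp => lt_of_le_of_ne (hmax p (hE hp)) fun h =>
      hq (readingKey.injective h ▸ hp)
  have hq : q.2 < q.1 := (mem_fpfPipeDreams.1 hE₀).1 q hqE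
  have hlast' : ∀ E ⊆ Q, q ∈ E → readingWord E = readingWord (E.erase q) ++ [q.1 + q.2] := by
    intro E hE hqE
    rw [← hlast _ ((Finset.erase_subset _ _).trans hE) (Finset.notMem_erase _ _),
      Finset.insert_erase hqE]
  have hdesc := (mem_fpfPipeDreams.1 hE₀).2
  rw [hlast' _ hEQ hqE] at hdesc
  refine Complex.ext_faces rfl fun S => ?_
  constructor
  · rintro ⟨⟨hSQ, E, hE, hES⟩, hSq⟩
    refine ⟨Finset.subset_sdiff.2 ⟨hSQ, Finset.disjoint_iff_inter_eq_empty.2 hSq⟩, ?_⟩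
    obtain ⟨hElt, hEr⟩ := mem_fpfPipeDreams.1 hE
    suffices h : ∃ E' ⊆ E, q ∉ E' ∧ IsReducedFPFWord
        (swap (q.1 + q.2) (q.1 + q.2 + 1) * z * swap (q.1 + q.2) (q.1 + q.2 + 1))
        (readingWord E') by
      obtain ⟨E', hEE, hqE', hr⟩ := h
      refine ⟨E', mem_fpfPipeDreams.2 ⟨fun p hp => hElt p (hEE hp), hr⟩, fun p hp => ?_⟩
      have hpq : p ≠ q := fun hpq => hqE' (hpq ▸ hp)
      have := Finset.mem_sdiff.1 (hES (hEE hp))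
      simp [hpq, this]
    -- A pipe dream using q loses its last letter; one avoiding q loses some other letter by
    -- exchange, as q is known to give a descent of z.
    by_cases hqE' : q ∈ E
    · rw [hlast' _ (hES.trans Finset.sdiff_subset) hqE'] at hEr
      exact ⟨E.erase q, Finset.erase_subset _ _, Finset.notMem_erase _ _, hEr.init⟩
    · obtain ⟨d, hd, hr⟩ := hEr.exists_sublist hdesc
      obtain ⟨E', hEE, rfl⟩ := exists_subset_of_sublist hd
      exact ⟨E', hEE, fun h => hqE' (hEE h), hr⟩
  · rintro ⟨hSQ, E, hE, hES⟩
    obtain ⟨hSQ', hSq⟩ := Finset.subset_sdiff.1 hSQ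
    obtain ⟨hElt, hEr⟩ := mem_fpfPipeDreams.1 hE
    have hE' : ∀ p ∈ E, p ∈ Q ∧ p ∉ S ∧ p ≠ q := fun p hp => by
      have := hES hp
      simp only [Finset.mem_sdiff, Finset.mem_singleton] at this
      tauto
    have hqE' : q ∉ E := fun h => (hE' q h).2.2 rfl
    refine ⟨⟨hSQ', insert q E, mem_fpfPipeDreams.2 ⟨?_, ?_⟩, ?_⟩,
      Finset.disjoint_iff_inter_eq_empty.1 hSq⟩
    · intro p hp
      rcases Finset.mem_insert.1 hp with rfl | hp
      · exact hq
      · exact hElt p hp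
    · rw [hlast E (fun p hp => (hE' p hp).1) hqE']
      -- Minimality is a count: `E` has the size of `E₀` without q, so adding q gives the size of
      -- `E₀`.
      refine ⟨by rw [fpfConj_concat, hEr.1, swap_conj_conj], fun c hc => ?_⟩
      have h1 := hdesc.2 c hc
      have h2 := hEr.length_eq hdesc.init
      simp at h1 ⊢
      omega
    · intro p hp
      rcases Finset.mem_insert.1 hp with rfl | hp
      · exact Finset.mem_sdiff.2 ⟨hEQ hqE, fun h => Finset.disjoint_left.1 hSq h (by simp)⟩
      · exact Finset.mem_sdiff.2 ⟨(hE' p hp).1, (hE' p hp).2.1⟩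

/-- The shedding vertex is the last position in reading order. The induction must range over all z,
since the deletion may replace z by a conjugate. -/
theorem subwordComplex_isVertexDecomposable (z : Perm ℕ) (Q : Finset (ℕ × ℕ)) :
    (subwordComplex z Q).IsVertexDecomposable := by
  induction hk : Q.card using Nat.strong_induction_on generalizing z Q with
  | _ k ih =>
    rcases Q.eq_empty_or_nonempty with rfl | hne
    · rcases (subwordComplex z ∅).faces.eq_empty_or_nonempty with h | ⟨S, hS⟩
      · exact .no_face _ h
      · refine .only_empty_face _ (Set.eq_singleton_iff_unique_mem.2 ⟨?_, fun T hT => ?_⟩)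
        · exact (subwordComplex z ∅).down_closed S hS ∅ (Finset.empty_subset _)
        · exact Finset.subset_empty.1 hT.1
    · obtain ⟨q, hq, hmax⟩ := Finset.exists_max_image Q readingKey hne
      have hcard : (Q \ {q}).card < k := hk ▸ Finset.card_lt_card
        (Finset.ssubset_iff_subset_ne.2 ⟨Finset.sdiff_subset, fun h => by
          have := h.symm ▸ hq
          simp at this⟩)
      refine .step _ (subwordComplex_isPure z Q) q hq ?_ ?_
      · by_cases h : ∃ E ∈ fpfPipeDreams z, E ⊆ Q ∧ q ∈ E
        · obtain ⟨E, hE, hEQ, hqE⟩ := h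
          rw [subwordComplex_deletion_of_mem z hmax hE hEQ hqE]
          exact ih _ hcard _ _ rfl
        · rw [subwordComplex_deletion_of_notMem z fun E hE hEQ hqE => h ⟨E, hE, hEQ, hqE⟩]
          exact ih _ hcard _ _ rfl
      · rw [subwordComplex_link z hq]
        exact ih _ hcard _ _ rfl

/-! ### Vertex-decomposable complexes are shellable -/

namespace Complex

variable {α : Type*}

theorem exists_isFacet (Δ : Complex α) {S : Finset α} (hS : S ∈ Δ.faces) :
    ∃ F, Δ.IsFacet F ∧ S ⊆ F := by
  have hfin : {T | T ∈ Δ.faces}.Finite :=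
    (Finset.finite_toSet Δ.vertices.powerset).subset fun T hT =>
      Finset.mem_coe.2 (Finset.mem_powerset.2 (Δ.subset_vertices T hT))
  obtain ⟨F, hSF, hF⟩ := hfin.exists_le_maximal hS
  exact ⟨F, ⟨hF.1, fun G hG hFG => le_antisymm hFG (hF.2 hG hFG)⟩, hSF⟩

/-- The condition on consecutive facets in a shelling: every face of `F` that lies in a member of
`P` lies in a codimension one face of `F` with this property. -/
def ShellingStep (P : List (Finset α)) (F : Finset α) : Prop :=
  ∀ E ⊆ F, ∀ H ∈ P, E ⊆ H → ∃ G, E ⊆ G ∧ G ⊆ F ∧ G.card + 1 = F.card ∧ ∃ H' ∈ P, G ⊆ H'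

theorem exists_lt_get_iff {L : List (Finset α)} {i : Fin L.length} {p : Finset α → Prop} :
    (∃ j < i, p (L.get j)) ↔ ∃ H ∈ L.take i, p H := by
  constructor
  · rintro ⟨j, hj, h⟩
    exact ⟨_, List.mem_take_iff_getElem.2 ⟨j, by have := j.2; have := i.2; omega, rfl⟩, h⟩
  · rintro ⟨H, hH, h⟩
    obtain ⟨j, hj, rfl⟩ := List.mem_take_iff_getElem.1 hH
    exact ⟨⟨j, by omega⟩, Fin.lt_def.2 (by simp; omega), h⟩

/-- The generating set can always be taken to be all codimension one faces of the current facet that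
lie in an earlier one, so the condition can be checked face by face. -/
theorem isShelling_iff {Δ : Complex α} {L : List (Finset α)} :
    Δ.IsShelling L ↔ L.Nodup ∧ (∀ F, F ∈ L ↔ Δ.IsFacet F) ∧
      ∀ i, (hi : i < L.length) → ShellingStep (L.take i) L[i] := by
  refine and_congr_right fun _ => and_congr_right fun _ => ?_
  rw [Fin.forall_iff]
  refine forall_congr' fun i => forall_congr' fun hi => ?_
  simp only [Set.ext_iff, Set.mem_ofPred_eq, exists_lt_get_iff (i := ⟨i, hi⟩)]
  constructor
  · rintro ⟨𝒢, h𝒢, h⟩ E hE H hH hEH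
    obtain ⟨G, hG, hEG⟩ := (h E).1 ⟨hE, H, hH, hEH⟩
    exact ⟨G, hEG, (h𝒢 G hG).1, (h𝒢 G hG).2, ((h G).2 ⟨G, hG, subset_rfl⟩).2⟩
  · intro h
    refine ⟨{G | G ⊆ L[i] ∧ G.card + 1 = L[i].card ∧ ∃ H ∈ L.take i, G ⊆ H},
      fun G hG => ⟨hG.1, hG.2.1⟩, fun E => ⟨?_, ?_⟩⟩
    · rintro ⟨hE, H, hH, hEH⟩
      obtain ⟨G, hEG, hG⟩ := h E hE H hH hEH
      exact ⟨G, hG, hEG⟩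
    · rintro ⟨G, ⟨hG, -, H, hH, hGH⟩, hEG⟩
      exact ⟨hEG.trans hG, H, hH, hEG.trans hGH⟩

variable [DecidableEq α]

theorem mem_deletion {Δ : Complex α} {v : α} {S : Finset α} :
    S ∈ (Δ.deletion {v}).faces ↔ S ∈ Δ.faces ∧ v ∉ S := by
  change _ ∧ _ ↔ _
  rw [← Finset.disjoint_iff_inter_eq_empty, Finset.disjoint_singleton_right]

theorem mem_link {Δ : Complex α} {v : α} {S : Finset α} :
    S ∈ (Δ.link {v}).faces ↔ v ∉ S ∧ insert v S ∈ Δ.faces := by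
  change _ ∧ _ ∧ _ ↔ _
  rw [← Finset.disjoint_iff_inter_eq_empty, Finset.disjoint_singleton_right, Finset.union_comm,
    ← Finset.insert_eq]
  exact ⟨fun h => h.2, fun h => ⟨Δ.down_closed _ h.2 _ (Finset.subset_insert _ _), h⟩⟩

theorem isFacet_and_mem_iff {Δ : Complex α} {v : α} {F : Finset α} :
    Δ.IsFacet F ∧ v ∈ F ↔ ∃ G, (Δ.link {v}).IsFacet G ∧ insert v G = F := by
  constructor
  · rintro ⟨⟨hF, hmax⟩, hv⟩
    refine ⟨F.erase v, ⟨mem_link.2 ⟨by simp, by rwa [Finset.insert_erase hv]⟩, fun G hG hFG => ?_⟩,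
      Finset.insert_erase hv⟩
    obtain ⟨hvG, hG⟩ := mem_link.1 hG
    rw [hmax _ hG, Finset.erase_insert hvG]
    rw [← Finset.insert_erase hv]
    exact Finset.insert_subset_insert _ hFG
  · rintro ⟨G, ⟨hG, hmax⟩, rfl⟩
    obtain ⟨hvG, hG⟩ := mem_link.1 hG
    refine ⟨⟨hG, fun H hH hGH => ?_⟩, Finset.mem_insert_self _ _⟩
    have hvH : v ∈ H := hGH (Finset.mem_insert_self _ _)
    rw [hmax (H.erase v) (mem_link.2 ⟨by simp, by rwa [Finset.insert_erase hvH]⟩)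
      (Finset.subset_erase.2 ⟨(Finset.subset_insert _ _).trans hGH, hvG⟩), Finset.insert_erase hvH]

theorem isFacet_and_notMem {Δ : Complex α} {v : α} {F : Finset α} (hF : Δ.IsFacet F)
    (hv : v ∉ F) : (Δ.deletion {v}).IsFacet F :=
  ⟨mem_deletion.2 ⟨hF.1, hv⟩, fun G hG => hF.2 G (mem_deletion.1 hG).1⟩

/-- In a pure complex with a facet avoiding `v`, the facets avoiding `v` are the facets of the
deletion of `v`, provided that the latter is pure. -/
theorem isFacet_and_notMem_iff {Δ : Complex α} {v : α} (hΔ : Δ.IsPure)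
    (hdel : (Δ.deletion {v}).IsPure) {F₀ : Finset α} (hF₀ : Δ.IsFacet F₀) (hv : v ∉ F₀)
    {F : Finset α} : Δ.IsFacet F ∧ v ∉ F ↔ (Δ.deletion {v}).IsFacet F := by
  refine ⟨fun h => isFacet_and_notMem h.1 h.2, fun h => ?_⟩
  obtain ⟨hF, hvF⟩ := mem_deletion.1 h.1
  obtain ⟨G, hG, hFG⟩ := Δ.exists_isFacet hF
  have hcard : F.card = G.card :=
    (hdel F F₀ h (isFacet_and_notMem hF₀ hv)).trans (hΔ F₀ G hF₀ hG)
  have := Finset.eq_of_subset_of_card_le hFG hcard.ge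
  exact ⟨this ▸ hG, hvF⟩

/-- Coning with v preserves shelling steps: remove v from the face, use the step below, and put v
back. -/
theorem ShellingStep.insert {P : List (Finset α)} {F : Finset α} (h : ShellingStep P F) {v : α}
    (hv : v ∉ F) {E : Finset α} (hE : E ⊆ insert v F) {H : Finset α} (hH : H ∈ P)
    (hEH : E ⊆ insert v H) :
    ∃ G, E ⊆ G ∧ G ⊆ insert v F ∧ G.card + 1 = (insert v F).card ∧
      ∃ H' ∈ P.map (insert v), G ⊆ H' := by
  obtain ⟨G, hEG, hGF, hcard, H', hH', hGH⟩ :=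
    h (E.erase v) (Finset.subset_insert_iff.1 hE) H hH
      (Finset.subset_insert_iff.1 hEH)
  refine ⟨Insert.insert v G, Finset.subset_insert_iff.2 hEG,
    Finset.insert_subset_insert _ hGF, ?_, _, List.mem_map.2 ⟨H', hH', rfl⟩,
    Finset.insert_subset_insert _ hGH⟩
  rw [Finset.card_insert_of_notMem hv, Finset.card_insert_of_notMem fun h => hv (hGF h), hcard]

/-- A shelling of the deletion is followed by the cone over a shelling of the link. If every facet
contains v, the cone alone suffices. -/
theorem IsVertexDecomposable.isShellable {Δ : Complex α} (h : Δ.IsVertexDecomposable) :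
    Δ.IsShellable := by
  induction h with
  | no_face Δ h =>
    have hF : ∀ F, ¬Δ.IsFacet F := fun F hF => by simpa [h] using hF.1
    exact ⟨fun F _ hF' => (hF F hF').elim, [], isShelling_iff.2 ⟨List.nodup_nil,
      fun F => ⟨fun h => by simp at h, fun h => (hF F h).elim⟩, fun i hi => by simp at hi⟩⟩
  | only_empty_face Δ h =>
    have hF : ∀ F, Δ.IsFacet F ↔ F = ∅ := fun F =>
      ⟨fun hF => by simpa [h] using hF.1, fun hF => by
        subst hF
        exact ⟨by simp [h], fun G hG _ => by simpa [h, eq_comm] using hG⟩⟩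
    refine ⟨fun F G hF' hG => by rw [(hF F).1 hF', (hF G).1 hG], [∅], isShelling_iff.2
      ⟨List.nodup_singleton _, fun F => by rw [hF, List.mem_singleton], fun i hi => ?_⟩⟩
    have : i = 0 := by simpa using hi
    subst this
    intro E _ H hH
    simp at hH
  | step Δ hpure v hv _ _ hdel hlink =>
    refine ⟨hpure, ?_⟩
    obtain ⟨hdp, A, hA⟩ := hdel
    obtain ⟨-, B, hB⟩ := hlink
    obtain ⟨hA1, hA2, hA3⟩ := isShelling_iff.1 hA
    obtain ⟨hB1, hB2, hB3⟩ := isShelling_iff.1 hB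
    have hvB : ∀ G ∈ B, v ∉ G := fun G hG => (mem_link.1 ((hB2 G).1 hG).1).1
    have hvA : ∀ G ∈ A, v ∉ G := fun G hG => (mem_deletion.1 ((hA2 G).1 hG).1).2
    have hBnd : (B.map (insert v)).Nodup := by
      refine hB1.map_on fun G hG H hH hGH => ?_
      rw [← Finset.erase_insert (hvB G hG), hGH, Finset.erase_insert (hvB H hH)]
    have hBmem : ∀ F, F ∈ B.map (insert v) ↔ Δ.IsFacet F ∧ v ∈ F := fun F => by
      simp only [List.mem_map, isFacet_and_mem_iff, hB2]
    by_cases hex : ∃ F₀, Δ.IsFacet F₀ ∧ v ∉ F₀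
    · obtain ⟨F₀, hF₀, hvF₀⟩ := hex
      refine ⟨A ++ B.map (insert v), isShelling_iff.2 ⟨?_, fun F => ?_, fun i hi => ?_⟩⟩
      · exact hA1.append hBnd fun F hFA hFB => hvA F hFA ((hBmem F).1 hFB).2
      · rw [List.mem_append, hBmem, hA2, ← isFacet_and_notMem_iff hpure hdp hF₀ hvF₀]
        tauto
      · rcases Nat.lt_or_ge i A.length with hiA | hiA
        · rw [List.take_append_of_le_length hiA.le, List.getElem_append_left hiA]
          exact hA3 i hiA
        · obtain ⟨k, rfl⟩ := Nat.exists_eq_add_of_le hiA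
          have hk : k < B.length := by simpa using hi
          rw [List.take_length_add_append, List.getElem_append_right hiA, ← List.map_take]
          simp only [Nat.add_sub_cancel_left, List.getElem_map]
          have hvk := hvB _ (List.getElem_mem hk)
          intro E hE H hH hEH
          -- Faces containing v meet only earlier coned facets, so the link's shelling handles them.
          -- A face avoiding v lies in the link facet `B[k]`, a codimension one face of the current
          -- facet that is contained in a facet of the deletion.
          by_cases hvE : v ∈ E
          · rcases List.mem_append.1 hH with hH | hH
            · exact (hvA H hH (hEH hvE)).elim
            · obtain ⟨H, hH', rfl⟩ := List.mem_map.1 hH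
              obtain ⟨G, h1, h2, h3, I, hI, h4⟩ := (hB3 k hk).insert hvk hE hH' hEH
              exact ⟨G, h1, h2, h3, I, List.mem_append_right _ hI, h4⟩
          · have hGl := mem_link.1 ((hB2 _).1 (List.getElem_mem hk)).1
            obtain ⟨H', hH', hGH⟩ := (Δ.deletion {v}).exists_isFacet (S := B[k])
              (mem_deletion.2 ⟨Δ.down_closed _ hGl.2 _ (Finset.subset_insert _ _), hvk⟩)
            exact ⟨B[k], (Finset.subset_insert_iff_of_notMem hvE).1 hE, Finset.subset_insert _ _,
              (Finset.card_insert_of_notMem hvk).symm, H',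
              List.mem_append_left _ ((hA2 H').2 hH'), hGH⟩
    · push Not at hex
      refine ⟨B.map (insert v), isShelling_iff.2 ⟨hBnd, fun F => ?_, fun i hi => ?_⟩⟩
      · rw [hBmem]
        exact ⟨fun h => h.1, fun h => ⟨h, hex F h⟩⟩
      · have hk : i < B.length := by simpa using hi
        rw [← List.map_take, List.getElem_map]
        intro E hE H hH hEH
        obtain ⟨H, hH', rfl⟩ := List.mem_map.1 hH
        exact (hB3 i hk).insert (hvB _ (List.getElem_mem hk)) hE hH' hEH

end Complex

end FPFSubword

/-- Neither hypothesis is needed: the argument applies to every permutation `z` (when `fpfPipeDreams z`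
is empty, the complex has no face) and to every finite set of positions `Q`. -/
theorem mainTheorem7 (n : ℕ) (z : Equiv.Perm ℕ)
    (hz : z ∈ FPFSubword.fpfStd n '' FPFSubword.involutions n)
    (Q : Finset (ℕ × ℕ)) (hQ : Q ⊆ FPFSubword.triangle n) :
    (FPFSubword.subwordComplex z Q).IsVertexDecomposable ∧
      (FPFSubword.subwordComplex z Q).IsShellable :=
  have h := FPFSubword.subwordComplex_isVertexDecomposable z Q
  ⟨h, h.isShellable⟩
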